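/- Let $R>0$ and let $v:[0,\infty)\to(0,\infty)$ be continuous with $\int_0^t v(s)\,ds\to\infty$ as $t\to\infty$ (for instance a constant $v>0$). Consider the unicycle in path coordinates $(\tilde l,\tilde\theta)$, $\tilde l=l/R$, $$\dot{\tilde l}=\frac{v}{R}\sin\tilde\theta,\qquad \dot{\tilde\theta}=\tilde\omega\in\Bigl\{0,\,-\frac vR,\,\frac vR\Bigr\},$$ the three input values being the manoeuvres go straight, turn right and turn left. Let $\delta:\mathbb R\to(-\pi,\pi)$ be continuous with $\tilde l\,\delta(\tilde l)>0$ for all $\tilde l\neq0$. Since $\dot{\tilde l}$ has the sign of $\sin\tilde\theta$, the heading that approaches the path is $\tilde\theta=-\delta(\tilde l)$. Put $$\sigma_R=\tilde l+1-\cos\tilde\theta,\quad \sigma_L=\tilde l-1+\cos\tilde\theta,\quad \sigma_N=\tilde l+1-2\cos\delta(\tilde l)+\cos\tilde\theta,\quad \sigma_P=\tilde l-1+2\cos\delta(\tilde l)-\cos\tilde\theta .$$ The hybrid controller chooses its state and its manoeuvre as follows; the first rule that applies is used. 1. Controlled state: turn right if $\tilde\theta>0$ and $\sigma_R=0$; turn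 left if $\tilde\theta<0$ and $\sigma_L=0$. 2. Turning state: turn right if $\sigma_P\le0$ and either $\tilde\theta>0,\ \sigma_R>0$ or $\tilde\theta\le0,\ \sigma_L>0$; turn left if $\sigma_N\ge0$ and either $\tilde\theta<0,\ \sigma_L<0$ or $\tilde\theta\ge0,\ \sigma_R<0$. 3. Turning state: turn left if $\tilde\theta<-\delta(\tilde l)$; turn right if $\tilde\theta>-\delta(\tilde l)$. 4. Straight state: go straight if $\tilde\theta=-\delta(\tilde l)$. Let $f_v(\tilde l,\tilde\theta)$ be the resulting discontinuous closed-loop vector field at speed $v$. A trajectory is a locally absolutely continuous curve $x:[0,\infty)\to\mathbb R^2$ with $\dot x(t)\in\bigcap_{\varepsilon>0}\overline{\mathrm{conv}}\,f_{v(t)}\bigl(B(x(t),\varepsilon)\bigr)$ for almost every $t>0$, so that sliding along $\tilde\theta=-\delta(\tilde l)$ by infinitely fast switching is allowed. Then, for initial states in $\mathbb R\times[-\pi,\pi)$, the origin $(\tilde l,\tilde\theta)=(0,0)$ is asymptotically stable, with the whole of $\mathbb R\times[-\pi,\pi)$ as region of attraction: for every $\varepsilon>0$ there is $\eta>0$ such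 that every trajectory that starts in $\mathbb R\times[-\pi,\pi)$ within distance $\eta$ of the origin stays within $\varepsilon$ of the origin for all $t\ge0$; and every trajectory that starts in $\mathbb R\times[-\pi,\pi)$ converges to the origin as $t\to\infty$. -/

import Mathlib

open Set Filter Topology MeasureTheory

/-! ### Manoeuvres and the path-coordinate unicycle

A state is a pair `p = (l̃, θ̃)`: the signed distance to the path divided by the turning radius `R`,
and the heading error in radians. -/

/-- The three admissible manoeuvres. -/
inductive Manoeuvre where
  | goStraight
  | turnRight
  | turnLeft

/-- The three states of the hybrid controller. -/
inductive ControlState where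
  | turning
  | straight
  | controlled

/-- The rate of change of `θ̃` under a manoeuvre, at forward speed `v` and turning radius `R`. -/
noncomputable def Manoeuvre.angularVelocity (v R : ℝ) : Manoeuvre → ℝ
  | .goStraight => 0
  | .turnRight => -(v / R)
  | .turnLeft => v / R

/-- The velocity of `(l̃, θ̃)` under a manoeuvre: `l' = v sin θ̃` with `l̃ = l / R`. -/
noncomputable def vehicleField (v R : ℝ) (m : Manoeuvre) (p : ℝ × ℝ) : ℝ × ℝ :=
  (v * Real.sin p.2 / R, m.angularVelocity v R)

/-! ### Switching curves -/

/-- Zero set: the right turn that passes through the origin. -/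
noncomputable def sigmaR (p : ℝ × ℝ) : ℝ := p.1 + 1 - Real.cos p.2

/-- Zero set: the left turn that passes through the origin. -/
noncomputable def sigmaL (p : ℝ × ℝ) : ℝ := p.1 - 1 + Real.cos p.2

/-- Zero set: the left turn that meets `sigmaR = 0` at heading error `± d`. -/
noncomputable def sigmaN (p : ℝ × ℝ) (d : ℝ) : ℝ := p.1 + 1 - 2 * Real.cos d + Real.cos p.2

/-- Zero set: the right turn that meets `sigmaL = 0` at heading error `± d`. -/
noncomputable def sigmaP (p : ℝ × ℝ) (d : ℝ) : ℝ := p.1 - 1 + 2 * Real.cos d - Real.cos p.2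

/-- The region from which a right turn is followed by a final left turn into the origin. It lies to
the right of the curve formed by `sigmaR = 0` (above `θ̃ = 0`) and `sigmaL = 0` (below), and to the
left of `sigmaP = 0`. -/
def lightRegion (δ : ℝ → ℝ) : Set (ℝ × ℝ) :=
  {p | sigmaP p (δ p.1) ≤ 0 ∧ ((0 < p.2 ∧ 0 < sigmaR p) ∨ (p.2 ≤ 0 ∧ 0 < sigmaL p))}

/-- The mirror image: a left turn is followed by a final right turn into the origin. -/
def darkRegion (δ : ℝ → ℝ) : Set (ℝ × ℝ) :=
  {p | 0 ≤ sigmaN p (δ p.1) ∧ ((p.2 < 0 ∧ sigmaL p < 0) ∨ (0 ≤ p.2 ∧ sigmaR p < 0))}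

/-! ### The hybrid controller -/

open Classical in
/-- The state-feedback form of the hybrid controller with approach-angle function `δ`. With
`l̃ δ(l̃) > 0` and `l' = v sin θ̃`, the heading that approaches the path is `θ̃ = -δ(l̃)`. -/
noncomputable def controller (δ : ℝ → ℝ) (p : ℝ × ℝ) : ControlState × Manoeuvre :=
  if 0 < p.2 ∧ sigmaR p = 0 then (.controlled, .turnRight)
  else if p.2 < 0 ∧ sigmaL p = 0 then (.controlled, .turnLeft)
  else if p ∈ lightRegion δ then (.turning, .turnRight)
  else if p ∈ darkRegion δ then (.turning, .turnLeft)
  else if p.2 < -δ p.1 then (.turning, .turnLeft)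
  else if -δ p.1 < p.2 then (.turning, .turnRight)
  else (.straight, .goStraight)

/-- The discontinuous closed-loop vector field at forward speed `v`. -/
noncomputable def closedLoopField (δ : ℝ → ℝ) (R v : ℝ) (p : ℝ × ℝ) : ℝ × ℝ :=
  vehicleField v R (controller δ p).2 p

/-! ### Trajectories, including sliding motions, and stability -/

/-- The Krasovskii regularization `⋂_{ε > 0} closure (conv f(B(p, ε)))` of a vector field. -/
def krasovskii (f : ℝ × ℝ → ℝ × ℝ) (p : ℝ × ℝ) : Set (ℝ × ℝ) :=
  ⋂ ε ∈ Ioi (0 : ℝ), closure (convexHull ℝ (f '' Metric.ball p ε))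

/-- Trajectories of the closed loop on `[0, ∞)` with forward speed `v t`: locally absolutely
continuous curves whose velocity lies almost everywhere in the regularized field. Infinitely fast
switching between manoeuvres (sliding) is thereby allowed. -/
def closedLoopTrajectories (δ : ℝ → ℝ) (R : ℝ) (v : ℝ → ℝ) : Set (ℝ → ℝ × ℝ) :=
  {x | (∀ T : ℝ, 0 ≤ T → AbsolutelyContinuousOnInterval x 0 T) ∧
    ∀ᵐ t : ℝ, 0 < t →
      ∃ y ∈ krasovskii (closedLoopField δ R (v t)) (x t), HasDerivAt x y t}

/-- Strong asymptotic stability of `x₀` with respect to the family `X` of trajectories, with region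
of attraction containing `D`: Lyapunov stability, and convergence of every trajectory from `D`. -/
def AsymptoticallyStableOn (X : Set (ℝ → ℝ × ℝ)) (D : Set (ℝ × ℝ)) (x₀ : ℝ × ℝ) : Prop :=
  (∀ ε > 0, ∃ η > 0, ∀ x ∈ X, x 0 ∈ D → dist (x 0) x₀ < η → ∀ t : ℝ, 0 ≤ t → dist (x t) x₀ < ε) ∧
  ∀ x ∈ X, x 0 ∈ D → Tendsto x atTop (𝓝 x₀)

/-! All rules of the hybrid controller amount to one: steer at full rate towards a continuous target
heading, namely `-δ l` clamped to `±arccos (1 - |l|)`, the headings of the full-rate turns through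
the origin. The two `controller_of_…` lemmas prove this off the curve `θ = targetHeading δ l`. On
that curve only the bound `|θ'| ≤ v / R` on the turning rate is needed, so sliding requires no
separate analysis, and a trajectory becomes a `SlidingMotion`.

A right turn conserves `sigmaR` and a left turn conserves `sigmaL`. Gluing `sigmaR` for `θ ≥ 0` to
`sigmaL` for `θ ≤ 0` gives the `offset` `l + signedVersine θ`, whose absolute value never increases.
A bound on the offset yields one on the position, and that yields one on the heading, so the sets
`Within l θ c` are forward invariant. As they shrink to the origin with `c`, this is Lyapunov
stability.

For attraction it remains to enter every such set. If the offset vanishes once, it stays zero and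
the vehicle follows the final turn, along which `l ^ 2` decreases. Otherwise the offset keeps a
sign, say positive: the heading becomes nonpositive, then bounded away from zero as long as `l > c`,
so `l` decreases until the set is reached. Infinite path length makes each of these phases end. -/

theorem LipschitzWith.comp_absolutelyContinuousOnInterval {X Y : Type*} [PseudoMetricSpace X]
    [PseudoMetricSpace Y] {K : NNReal} {g : X → Y} (hg : LipschitzWith K g) {f : ℝ → X} {a b : ℝ}
    (hf : AbsolutelyContinuousOnInterval f a b) :
    AbsolutelyContinuousOnInterval (fun t => g (f t)) a b := by
  unfold AbsolutelyContinuousOnInterval at hf ⊢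
  refine squeeze_zero (fun E => Finset.sum_nonneg fun i _ => dist_nonneg) (fun E => ?_)
    (by simpa using hf.const_mul (K : ℝ))
  rw [Finset.mul_sum]
  exact Finset.sum_le_sum fun i _ => hg.dist_le_mul _ _

/-! ### Barrier and drift arguments for absolutely continuous functions -/

/-- Absolute continuity on every interval `[0, T]`. -/
def LocallyAC (f : ℝ → ℝ) : Prop := ∀ T : ℝ, 0 ≤ T → AbsolutelyContinuousOnInterval f 0 T

namespace LocallyAC

variable {f g w : ℝ → ℝ} {a b c κ : ℝ}

theorem on_interval (hf : LocallyAC f) (ha : 0 ≤ a) (hb : 0 ≤ b) :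
    AbsolutelyContinuousOnInterval f a b := by
  refine (hf (max a b) (ha.trans (le_max_left _ _))).mono ?_
  rw [uIcc_of_le (ha.trans (le_max_left _ _))]
  exact uIcc_subset_Icc ⟨ha, le_max_left _ _⟩ ⟨hb, le_max_right _ _⟩

theorem continuousOn (hf : LocallyAC f) : ContinuousOn f (Ici 0) := by
  intro t ht
  have ht : (0 : ℝ) ≤ t := ht
  have h := (hf (t + 1) (by linarith)).continuousOn
  rw [uIcc_of_le (by linarith)] at h
  refine (h t ⟨ht, by linarith⟩).mono_of_mem_nhdsWithin ?_
  rw [mem_nhdsWithin]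
  exact ⟨Iio (t + 1), isOpen_Iio, by simp, fun s hs => ⟨hs.2, hs.1.le⟩⟩

theorem neg (hf : LocallyAC f) : LocallyAC fun t => -f t := fun T hT => (hf T hT).fun_neg

theorem add (hf : LocallyAC f) (hg : LocallyAC g) : LocallyAC fun t => f t + g t :=
  fun T hT => (hf T hT).fun_add (hg T hT)

theorem mul (hf : LocallyAC f) (hg : LocallyAC g) : LocallyAC fun t => f t * g t :=
  fun T hT => (hf T hT).fun_mul (hg T hT)

theorem le_sub_integral (hf : LocallyAC f) (ha : 0 ≤ a) (hab : a ≤ b)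
    (hw : IntervalIntegrable w volume a b)
    (h : ∀ᵐ t : ℝ, a < t → t < b → ∃ d ≤ -(κ * w t), HasDerivAt f d t) :
    f b ≤ f a - κ * ∫ t in a..b, w t := by
  have hac := hf.on_interval ha (ha.trans hab)
  have hle : ∫ t in a..b, deriv f t ≤ ∫ t in a..b, -(κ * w t) := by
    refine intervalIntegral.integral_mono_ae_restrict hab hac.intervalIntegrable_deriv
      (hw.const_mul κ).neg ?_
    rw [EventuallyLE, ae_restrict_iff' measurableSet_Icc]
    have ha' : ∀ᵐ t : ℝ, t ≠ a := by simp [ae_iff, measure_singleton]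
    have hb' : ∀ᵐ t : ℝ, t ≠ b := by simp [ae_iff, measure_singleton]
    filter_upwards [h, ha', hb'] with t ht hta htb htab
    obtain ⟨d, hd, hd'⟩ := ht (lt_of_le_of_ne htab.1 (Ne.symm hta)) (lt_of_le_of_ne htab.2 htb)
    rw [hd'.deriv]
    exact hd
  rw [hac.integral_deriv_eq_sub, intervalIntegral.integral_neg,
    intervalIntegral.integral_const_mul] at hle
  linarith

theorem le_of_deriv_nonpos (hf : LocallyAC f) (ha : 0 ≤ a) (hab : a ≤ b)
    (h : ∀ᵐ t : ℝ, a < t → t < b → ∃ d ≤ 0, HasDerivAt f d t) : f b ≤ f a := by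
  have := hf.le_sub_integral (w := fun _ => 0) (κ := 0) ha hab (by simp) (by simpa using h)
  simpa using this

/-- A level that the function cannot cross upwards. -/
theorem le_of_local_barrier (hf : LocallyAC f) (ha : 0 ≤ a) (hfa : f a ≤ c)
    (h : ∀ s, a ≤ s → f s = c → ∃ r > s,
      ∀ᵐ t : ℝ, s < t → t < r → c < f t → ∃ d ≤ 0, HasDerivAt f d t) :
    ∀ t, a ≤ t → f t ≤ c := by
  intro b hab
  by_contra! hb
  have hcont : ContinuousOn f (Icc a b) := hf.continuousOn.mono fun t ht => ha.trans ht.1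
  have hclosed : IsClosed (Icc a b ∩ f ⁻¹' Iic c) :=
    hcont.preimage_isClosed_of_isClosed isClosed_Icc isClosed_Iic
  have hne : (Icc a b ∩ f ⁻¹' Iic c).Nonempty := ⟨a, ⟨le_rfl, hab⟩, hfa⟩
  have hbdd : BddAbove (Icc a b ∩ f ⁻¹' Iic c) := ⟨b, fun t ht => ht.1.2⟩
  have hmem := hclosed.csSup_mem hne hbdd
  -- The last time before `b` at which `f ≤ c`: the derivative bound is needed only just after `s`.
  set s := sSup (Icc a b ∩ f ⁻¹' Iic c)
  obtain ⟨⟨has, hsb⟩, hsc⟩ := hmem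
  have hsc : f s ≤ c := hsc
  have hgt : ∀ t, s < t → t ≤ b → c < f t := by
    intro t hst htb
    by_contra! hle
    exact absurd (le_csSup hbdd ⟨⟨has.trans hst.le, htb⟩, hle⟩) (not_le.2 hst)
  have hsb' : s < b := lt_of_le_of_ne hsb fun he => by rw [he] at hsc; linarith
  have hfs : f s = c := by
    by_contra hne'
    have hlt : f s < c := lt_of_le_of_ne hsc hne'
    obtain ⟨t, ht, hft⟩ := intermediate_value_Icc hsb (hcont.mono (Icc_subset_Icc_left has))
      ⟨hlt.le, hb.le⟩
    have hst : s < t := lt_of_le_of_ne ht.1 fun he => by rw [← he] at hft; exact hne' hft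
    exact absurd (hgt t hst ht.2) (by rw [hft]; exact lt_irrefl _)
  obtain ⟨r, hr, hae⟩ := h s has hfs
  have hm : s < min r b := lt_min hr hsb'
  have hle := hf.le_of_deriv_nonpos (ha.trans has) hm.le (by
    filter_upwards [hae] with t ht hst htm
    exact ht hst (htm.trans_le (min_le_left _ _)) (hgt t hst (htm.le.trans (min_le_right _ _))))
  have := hgt _ hm (min_le_right _ _)
  linarith

theorem le_of_barrier (hf : LocallyAC f) (ha : 0 ≤ a) (hfa : f a ≤ c)
    (h : ∀ᵐ t : ℝ, a < t → c < f t → ∃ d ≤ 0, HasDerivAt f d t) : ∀ t, a ≤ t → f t ≤ c := by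
  refine hf.le_of_local_barrier ha hfa fun s hs _ => ⟨s + 1, by linarith, ?_⟩
  filter_upwards [h] with t ht hst _ hc
  exact ht (hs.trans_lt hst) hc

/-- A function that decreases at rate at least `κ w` above the level `c`, where `w` has infinite
integral, is eventually below that level. -/
theorem eventually_le_of_drift (hf : LocallyAC f) (ha : 0 ≤ a) (hκ : 0 < κ)
    (hw_nonneg : ∀ t, 0 ≤ t → 0 ≤ w t)
    (hw : ∀ t, 0 ≤ t → IntervalIntegrable w volume 0 t)
    (hw_tendsto : Tendsto (fun t => ∫ s in (0 : ℝ)..t, w s) atTop atTop)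
    (h : ∀ᵐ t : ℝ, a < t → c < f t → ∃ d ≤ -(κ * w t), HasDerivAt f d t) :
    ∃ b, a ≤ b ∧ ∀ t, b ≤ t → f t ≤ c := by
  obtain ⟨b, hab, hb⟩ : ∃ b, a ≤ b ∧ f b ≤ c := by
    by_contra! hgt
    -- By time `t` the guaranteed decrease since `a` is at least `f a - c`.
    obtain ⟨t, ht, hta⟩ := ((hw_tendsto.eventually_ge_atTop
      ((∫ s in (0 : ℝ)..a, w s) + (f a - c) / κ)).and (eventually_ge_atTop a)).exists
    have hint : IntervalIntegrable w volume a t := (hw a ha).symm.trans (hw t (ha.trans hta))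
    have hle := hf.le_sub_integral (κ := κ) ha hta hint (by
      filter_upwards [h] with s hs has _
      exact hs has (hgt s has.le))
    rw [← intervalIntegral.integral_interval_sub_left (hw t (ha.trans hta)) (hw a ha)] at hle
    have h2 : κ * ((f a - c) / κ) = f a - c := by field_simp
    have h3 := mul_le_mul_of_nonneg_left ht hκ.le
    have := hgt t hta
    nlinarith
  refine ⟨b, hab, hf.le_of_barrier (ha.trans hab) hb ?_⟩
  filter_upwards [h] with t ht hbt hc
  obtain ⟨d, hd, hd'⟩ := ht (hab.trans_lt hbt) hc
  refine ⟨d, hd.trans ?_, hd'⟩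
  have := mul_nonneg hκ.le (hw_nonneg t (ha.trans (hab.trans hbt.le)))
  linarith

end LocallyAC

/-! ### The signed versine -/

/-- The versine `1 - cos θ` with the sign of `θ`. -/
noncomputable def signedVersine (θ : ℝ) : ℝ := if 0 ≤ θ then 1 - Real.cos θ else Real.cos θ - 1

theorem signedVersine_of_nonneg {θ : ℝ} (h : 0 ≤ θ) : signedVersine θ = 1 - Real.cos θ := if_pos h

theorem signedVersine_of_nonpos {θ : ℝ} (h : θ ≤ 0) : signedVersine θ = Real.cos θ - 1 := by
  rcases h.lt_or_eq with h | rfl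
  · exact if_neg (not_le.2 h)
  · simp [signedVersine]

theorem signedVersine_zero : signedVersine 0 = 0 := by simp [signedVersine]

theorem signedVersine_neg (θ : ℝ) : signedVersine (-θ) = -signedVersine θ := by
  rcases le_total 0 θ with h | h
  · rw [signedVersine_of_nonneg h, signedVersine_of_nonpos (by linarith), Real.cos_neg]; ring
  · rw [signedVersine_of_nonpos h, signedVersine_of_nonneg (by linarith), Real.cos_neg]; ring

theorem signedVersine_nonpos {θ : ℝ} (h : θ ≤ 0) : signedVersine θ ≤ 0 := by
  rw [signedVersine_of_nonpos h]; linarith [Real.cos_le_one θ]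

theorem signedVersine_nonneg {θ : ℝ} (h : 0 ≤ θ) : 0 ≤ signedVersine θ := by
  rw [signedVersine_of_nonneg h]; linarith [Real.cos_le_one θ]

theorem pos_of_signedVersine_pos {θ : ℝ} (h : 0 < signedVersine θ) : 0 < θ := by
  by_contra! hθ
  exact absurd (signedVersine_nonpos hθ) (not_le.2 h)

theorem abs_signedVersine (θ : ℝ) : |signedVersine θ| = 1 - Real.cos θ := by
  rcases le_total 0 θ with h | h
  · rw [abs_of_nonneg (signedVersine_nonneg h), signedVersine_of_nonneg h]
  · rw [abs_of_nonpos (signedVersine_nonpos h), signedVersine_of_nonpos h]; ring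

/-- The two branches join differentiably because `sin 0 = 0`; hence the chain rule also holds while
the heading crosses zero. -/
theorem hasDerivAt_signedVersine (θ : ℝ) :
    HasDerivAt signedVersine (if 0 ≤ θ then Real.sin θ else -Real.sin θ) θ := by
  have hpos : HasDerivAt (fun x => 1 - Real.cos x) (Real.sin θ) θ := by
    simpa using (Real.hasDerivAt_cos θ).const_sub 1
  have hneg : HasDerivAt (fun x => Real.cos x - 1) (-Real.sin θ) θ :=
    (Real.hasDerivAt_cos θ).sub_const 1
  rcases lt_trichotomy θ 0 with h | rfl | h
  · rw [if_neg (not_le.2 h)]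
    refine hneg.congr_of_eventuallyEq ?_
    filter_upwards [Iio_mem_nhds h] with x hx using signedVersine_of_nonpos (le_of_lt hx)
  · rw [if_pos le_rfl]
    have h1 : HasDerivWithinAt signedVersine (Real.sin 0) (Ici 0) 0 :=
      hpos.hasDerivWithinAt.congr (fun x hx => signedVersine_of_nonneg hx)
        (signedVersine_of_nonneg le_rfl)
    have h2 : HasDerivWithinAt signedVersine (Real.sin 0) (Iic 0) 0 := by
      have := hneg.hasDerivWithinAt.congr (s := Iic 0) (fun x hx => signedVersine_of_nonpos hx)
        (signedVersine_of_nonpos le_rfl)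
      simpa using this
    have h3 := h2.union h1
    rwa [Iic_union_Ici, hasDerivWithinAt_univ] at h3
  · rw [if_pos h.le]
    refine hpos.congr_of_eventuallyEq ?_
    filter_upwards [Ioi_mem_nhds h] with x hx using signedVersine_of_nonneg (le_of_lt hx)

theorem lipschitzWith_signedVersine : LipschitzWith 1 signedVersine := by
  refine lipschitzWith_of_nnnorm_deriv_le
    (fun θ => (hasDerivAt_signedVersine θ).differentiableAt) fun θ => ?_
  rw [(hasDerivAt_signedVersine θ).deriv, ← NNReal.coe_le_coe, coe_nnnorm, Real.norm_eq_abs]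
  split_ifs
  · exact Real.abs_sin_le_one θ
  · rw [abs_neg]; exact Real.abs_sin_le_one θ

theorem sin_sq_lower_bound {κ M θ : ℝ} (hκ : 0 ≤ κ) (hM : M ≤ Real.pi) (h1 : κ ≤ |θ|)
    (h2 : |θ| ≤ M) : (1 - Real.cos κ) * (1 + Real.cos M) ≤ Real.sin θ ^ 2 := by
  have h3 : Real.cos θ ≤ Real.cos κ := by
    rw [← Real.cos_abs θ]
    exact Real.cos_le_cos_of_nonneg_of_le_pi hκ (h2.trans hM) h1
  have h4 : Real.cos M ≤ Real.cos θ := by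
    rw [← Real.cos_abs θ]
    exact Real.cos_le_cos_of_nonneg_of_le_pi (abs_nonneg _) hM h2
  have h5 : Real.sin θ ^ 2 = (1 - Real.cos θ) * (1 + Real.cos θ) := by
    rw [Real.sin_sq]; ring
  rw [h5]
  apply mul_le_mul <;> linarith [Real.cos_le_one θ, Real.neg_one_le_cos M]

/-! ### Sliding motions: invariant sets -/

/-- A motion with speed `w` and heading `θ` that steers at full rate towards the heading `h l`. The
curve `θ = h l` lies between the path and the full-rate turns through the origin. -/
structure SlidingMotion (h w l θ : ℝ → ℝ) : Prop where
  continuous_heading : Continuous h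
  heading_neg : ∀ x, 0 < x → h x < 0
  heading_pos : ∀ x, x < 0 → 0 < h x
  abs_heading_lt_pi : ∀ x, |h x| < Real.pi
  abs_heading_le : ∀ x, |h x| ≤ Real.arccos (1 - |x|)
  speed_nonneg : ∀ t, 0 ≤ t → 0 ≤ w t
  speed_integrable : ∀ t, 0 ≤ t → IntervalIntegrable w volume 0 t
  tendsto_path_length : Tendsto (fun t => ∫ s in (0 : ℝ)..t, w s) atTop atTop
  position_ac : LocallyAC l
  heading_ac : LocallyAC θ
  abs_angle_le_pi : ∀ t, 0 ≤ t → |θ t| ≤ Real.pi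
  ae_hasDerivAt : ∀ᵐ t : ℝ, 0 < t → HasDerivAt l (w t * Real.sin (θ t)) t ∧
    ∃ u, HasDerivAt θ u t ∧ |u| ≤ w t ∧ (h (l t) < θ t → u = -w t) ∧ (θ t < h (l t) → u = w t)

namespace SlidingMotion

variable {h w l θ : ℝ → ℝ} {a c M : ℝ}

/-- Reflection in the path, by which every one-sided estimate below yields its mirror image. -/
theorem neg (H : SlidingMotion h w l θ) :
    SlidingMotion (fun x => -h (-x)) w (fun t => -l t) (fun t => -θ t) where
  continuous_heading := (H.continuous_heading.comp continuous_neg).neg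
  heading_neg x hx := neg_lt_zero.2 (H.heading_pos _ (neg_lt_zero.2 hx))
  heading_pos x hx := neg_pos.2 (H.heading_neg _ (neg_pos.2 hx))
  abs_heading_lt_pi x := by rw [abs_neg]; exact H.abs_heading_lt_pi _
  abs_heading_le x := by simpa using H.abs_heading_le (-x)
  speed_nonneg := H.speed_nonneg
  speed_integrable := H.speed_integrable
  tendsto_path_length := H.tendsto_path_length
  position_ac := H.position_ac.neg
  heading_ac := H.heading_ac.neg
  abs_angle_le_pi t ht := by rw [abs_neg]; exact H.abs_angle_le_pi t ht
  ae_hasDerivAt := by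
    filter_upwards [H.ae_hasDerivAt] with t ht h0
    obtain ⟨h1, u, h2, h3, h4, h5⟩ := ht h0
    refine ⟨by simpa using h1.fun_neg, -u, h2.fun_neg, by rwa [abs_neg], fun h => ?_, fun h => ?_⟩
    · rw [neg_neg] at h; rw [h5 (by linarith)]
    · rw [neg_neg] at h; rw [h4 (by linarith), neg_neg]

/-- The signed offset, at heading zero, of the full-rate turn towards the path direction. -/
noncomputable def offset (l θ : ℝ → ℝ) (t : ℝ) : ℝ := l t + signedVersine (θ t)

theorem offset_neg (l θ : ℝ → ℝ) (t : ℝ) :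
    offset (fun t => -l t) (fun t => -θ t) t = -offset l θ t := by
  simp only [offset, signedVersine_neg]; ring

theorem signedVersine_ac (H : SlidingMotion h w l θ) : LocallyAC fun t => signedVersine (θ t) :=
  fun T hT => lipschitzWith_signedVersine.comp_absolutelyContinuousOnInterval (H.heading_ac T hT)

theorem offset_ac (H : SlidingMotion h w l θ) : LocallyAC (offset l θ) :=
  H.position_ac.add H.signedVersine_ac

theorem heading_lt_of_abs_lt (H : SlidingMotion h w l θ) {x α : ℝ} (h0 : 0 ≤ α)
    (hx : |x| < 1 - Real.cos α) : h x < α := by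
  refine (le_abs_self _).trans_lt ((H.abs_heading_le x).trans_lt ?_)
  by_contra! hα
  have h1 := Real.cos_le_cos_of_nonneg_of_le_pi h0 (Real.arccos_le_pi _) hα
  rw [Real.cos_arccos (by linarith [Real.neg_one_le_cos α]) (by linarith [abs_nonneg x])] at h1
  linarith

/-- For `x < 0` the offset condition says `|x| < 1 - cos α`, so `α` exceeds the limit `arccos (1 -
|x|)` on the target; for `x > 0` the target is negative. -/
theorem heading_lt_of_offset_pos (H : SlidingMotion h w l θ) {x α : ℝ} (h0 : 0 < α)
    (hx : 0 < x + signedVersine α) : h x < α := by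
  rcases lt_trichotomy x 0 with hx0 | rfl | hx0
  · refine H.heading_lt_of_abs_lt h0.le ?_
    rw [abs_of_neg hx0]
    rw [signedVersine_of_nonneg h0.le] at hx
    linarith
  · refine H.heading_lt_of_abs_lt h0.le ?_
    rw [signedVersine_of_nonneg h0.le] at hx
    simpa using hx
  · exact (H.heading_neg x hx0).trans h0

/-- Where the offset is positive, a heading `θ > 0` lies above the target, so the vehicle turns
right and the offset is conserved. For `θ < 0` its derivative is `(w - u) sin θ ≤ 0`. -/
theorem offset_le (H : SlidingMotion h w l θ) (ha : 0 ≤ a) (hc : 0 ≤ c) (hoff : offset l θ a ≤ c) :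
    ∀ t, a ≤ t → offset l θ t ≤ c := by
  refine H.offset_ac.le_of_barrier ha hoff ?_
  filter_upwards [H.ae_hasDerivAt] with t ht hat hct
  have h0 := ha.trans_lt hat
  obtain ⟨h1, u, h2, h3, h4, h5⟩ := ht h0
  refine ⟨_, ?_, h1.add ((hasDerivAt_signedVersine (θ t)).comp t h2)⟩
  have hπ := abs_le.1 (H.abs_angle_le_pi t h0.le)
  rcases lt_trichotomy (θ t) 0 with hθ | hθ | hθ
  · rw [if_neg (not_le.2 hθ)]
    have hs := Real.sin_nonpos_of_nonpos_of_neg_pi_le hθ.le hπ.1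
    nlinarith [le_abs_self u]
  · simp [hθ]
  · rw [if_pos hθ.le, h4 (H.heading_lt_of_offset_pos hθ (hc.trans_lt hct))]
    linarith

theorem le_offset (H : SlidingMotion h w l θ) (ha : 0 ≤ a) (hc : 0 ≤ c) (hoff : -c ≤ offset l θ a) :
    ∀ t, a ≤ t → -c ≤ offset l θ t := by
  intro t ht
  have := H.neg.offset_le ha hc (by rw [offset_neg]; linarith) t ht
  rw [offset_neg] at this
  linarith

/-- Where `l > c ≥ offset`, the versine term is negative, so the vehicle heads towards the path. -/
theorem position_le (H : SlidingMotion h w l θ) (ha : 0 ≤ a) (hc : 0 ≤ c)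
    (hoff : offset l θ a ≤ c) (hl : l a ≤ c) : ∀ t, a ≤ t → l t ≤ c := by
  refine H.position_ac.le_of_barrier ha hl ?_
  filter_upwards [H.ae_hasDerivAt] with t ht hat hct
  have h0 := ha.trans_lt hat
  refine ⟨_, ?_, (ht h0).1⟩
  have hoff' := H.offset_le ha hc hoff t hat.le
  have hθ : θ t ≤ 0 := by
    by_contra! hθ
    have := signedVersine_nonneg hθ.le
    rw [offset] at hoff'
    linarith
  exact mul_nonpos_of_nonneg_of_nonpos (H.speed_nonneg t h0.le)
    (Real.sin_nonpos_of_nonpos_of_neg_pi_le hθ (abs_le.1 (H.abs_angle_le_pi t h0.le)).1)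

/-- Position, signed versine of the heading and offset are at most `c` in absolute value. -/
def Within (l θ : ℝ → ℝ) (c t : ℝ) : Prop :=
  |offset l θ t| ≤ c ∧ |l t| ≤ c ∧ |signedVersine (θ t)| ≤ c

/-- A signed versine above `c ≥ |l|` puts the heading beyond `arccos (1 - |l|)`, hence above the
target, and the vehicle turns back. -/
theorem signedVersine_le (H : SlidingMotion h w l θ) (ha : 0 ≤ a) (hc : 0 ≤ c)
    (hl : ∀ t, a ≤ t → |l t| ≤ c) (hs : signedVersine (θ a) ≤ c) :
    ∀ t, a ≤ t → signedVersine (θ t) ≤ c := by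
  refine H.signedVersine_ac.le_of_barrier ha hs ?_
  filter_upwards [H.ae_hasDerivAt] with t ht hat hct
  have h0 := ha.trans_lt hat
  obtain ⟨h1, u, h2, h3, h4, h5⟩ := ht h0
  refine ⟨_, ?_, (hasDerivAt_signedVersine (θ t)).comp t h2⟩
  have hπ := abs_le.1 (H.abs_angle_le_pi t h0.le)
  have hθ := pos_of_signedVersine_pos (hc.trans_lt hct)
  rw [signedVersine_of_nonneg hθ.le] at hct
  rw [if_pos hθ.le, h4 (H.heading_lt_of_abs_lt hθ.le ((hl t hat.le).trans_lt hct))]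
  have := mul_nonneg (Real.sin_nonneg_of_nonneg_of_le_pi hθ.le hπ.2) (H.speed_nonneg t h0.le)
  linarith

theorem within_of_within (H : SlidingMotion h w l θ) (ha : 0 ≤ a) (hw : Within l θ c a) :
    ∀ t, a ≤ t → Within l θ c t := by
  obtain ⟨h1, h2, h3⟩ := hw
  have hc : 0 ≤ c := (abs_nonneg _).trans h1
  have hl : ∀ t, a ≤ t → |l t| ≤ c := by
    intro t ht
    have hneg := H.neg.position_le ha hc
      (by rw [offset_neg]; linarith [(abs_le.1 h1).1]) (by linarith [(abs_le.1 h2).1]) t ht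
    exact abs_le.2 ⟨by linarith, H.position_le ha hc (abs_le.1 h1).2 (abs_le.1 h2).2 t ht⟩
  intro t ht
  refine ⟨abs_le.2 ⟨H.le_offset ha hc (abs_le.1 h1).1 t ht, H.offset_le ha hc (abs_le.1 h1).2 t ht⟩,
    hl t ht, abs_le.2 ⟨?_, H.signedVersine_le ha hc hl (abs_le.1 h3).2 t ht⟩⟩
  have hneg := H.neg.signedVersine_le ha hc (fun s hs => by rw [abs_neg]; exact hl s hs)
    (by rw [signedVersine_neg]; linarith [(abs_le.1 h3).1]) t ht
  rw [signedVersine_neg] at hneg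
  linarith

theorem exists_forall_abs_position_le (H : SlidingMotion h w l θ) :
    ∃ c, ∀ t, 0 ≤ t → |l t| ≤ c := by
  refine ⟨max |offset l θ 0| (max |l 0| |signedVersine (θ 0)|), fun t ht => ?_⟩
  exact (H.within_of_within le_rfl ⟨le_max_left _ _, (le_max_left _ _).trans (le_max_right _ _),
    (le_max_right _ _).trans (le_max_right _ _)⟩ t ht).2.1

/-! ### Sliding motions: attraction -/

theorem eventually_angle_le (H : SlidingMotion h w l θ) (ha : 0 ≤ a)
    (hM : ∀ t, a ≤ t → M < θ t → h (l t) < θ t) : ∃ b, a ≤ b ∧ ∀ t, b ≤ t → θ t ≤ M := by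
  refine H.heading_ac.eventually_le_of_drift ha one_pos H.speed_nonneg H.speed_integrable
    H.tendsto_path_length ?_
  filter_upwards [H.ae_hasDerivAt] with t ht hat hMt
  obtain ⟨h1, u, h2, h3, h4, h5⟩ := ht (ha.trans_lt hat)
  exact ⟨u, by rw [h4 (hM t hat.le hMt), one_mul], h2⟩

/-- The position stays in a compact interval, on which the target is bounded away from `±π`. This
excludes stalling near `θ = ±π`, where `sin θ` vanishes too. -/
theorem exists_eventually_abs_angle_le (H : SlidingMotion h w l θ) :
    ∃ M < Real.pi, ∃ b, 0 ≤ b ∧ ∀ t, b ≤ t → |θ t| ≤ M := by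
  obtain ⟨c, hc⟩ := H.exists_forall_abs_position_le
  have hc0 : 0 ≤ c := (abs_nonneg _).trans (hc 0 le_rfl)
  obtain ⟨x, -, hx⟩ := (isCompact_Icc (a := -c) (b := c)).exists_isMaxOn
    ⟨0, by linarith, hc0⟩ H.continuous_heading.abs.continuousOn
  have hM : ∀ t, 0 ≤ t → |h (l t)| ≤ |h x| := fun t ht => hx (abs_le.1 (hc t ht))
  obtain ⟨b, hb, hb'⟩ := H.eventually_angle_le (M := |h x|) le_rfl fun t ht hlt =>
    ((le_abs_self _).trans (hM t ht)).trans_lt hlt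
  obtain ⟨b₂, hb₂, hb₂'⟩ := H.neg.eventually_angle_le (M := |h x|) le_rfl fun t ht hlt => by
    rw [neg_neg]
    exact ((neg_le_abs _).trans (hM t ht)).trans_lt hlt
  refine ⟨|h x|, H.abs_heading_lt_pi x, max b b₂, hb.trans (le_max_left _ _), fun t ht => ?_⟩
  rw [max_le_iff] at ht
  exact abs_le.2 ⟨by linarith [hb₂' t ht.2], hb' t ht.1⟩

theorem exists_within_of_offset_eq_zero (H : SlidingMotion h w l θ) (ha : 0 ≤ a)
    (hM : M < Real.pi) (hθ : ∀ t, a ≤ t → |θ t| ≤ M) (hoff : offset l θ a = 0) (hc : 0 < c) :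
    ∃ t, 0 ≤ t ∧ Within l θ c t := by
  by_contra! hnot
  have hoff0 : ∀ t, a ≤ t → offset l θ t = 0 := fun t ht =>
    le_antisymm (H.offset_le ha le_rfl hoff.le t ht)
      (by simpa using H.le_offset ha le_rfl (by rw [hoff, neg_zero]) t ht)
  have hl : ∀ t, a ≤ t → l t = -signedVersine (θ t) := fun t ht => by
    have := hoff0 t ht
    rw [offset] at this
    linarith
  have hlarge : ∀ t, a ≤ t → c < |signedVersine (θ t)| := by
    intro t ht
    by_contra! hle
    exact hnot t (ha.trans ht)
      ⟨by rw [hoff0 t ht, abs_zero]; exact hc.le, by rwa [hl t ht, abs_neg], hle⟩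
  have hM0 : 0 ≤ M := (abs_nonneg _).trans (hθ a le_rfl)
  have hcosM : 0 < 1 + Real.cos M := by
    have := Real.cos_lt_cos_of_nonneg_of_le_pi hM0 le_rfl hM
    rw [Real.cos_pi] at this
    linarith
  -- With `l = -signedVersine θ`, `(l ^ 2)' = -2 w |signedVersine θ| |sin θ|`. The first factor
  -- exceeds `c`, and `|sin θ| ≥ sin² θ = (1 - cos θ)(1 + cos θ) ≥ c (1 + cos M)`.
  obtain ⟨b, hab, hb⟩ := (H.position_ac.mul H.position_ac).eventually_le_of_drift (c := 0)
    (κ := c * (c * (1 + Real.cos M))) ha (by positivity) H.speed_nonneg H.speed_integrable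
    H.tendsto_path_length (by
      filter_upwards [H.ae_hasDerivAt] with t ht hat _
      have h0 := ha.trans_lt hat
      have h1 := (ht h0).1
      refine ⟨_, ?_, h1.mul h1⟩
      have hw := H.speed_nonneg t h0.le
      have hv := hlarge t hat.le
      have hπ := abs_le.1 (H.abs_angle_le_pi t h0.le)
      have hsq : c * (1 + Real.cos M) ≤ Real.sin (θ t) ^ 2 := by
        have h4 := Real.cos_le_cos_of_nonneg_of_le_pi (abs_nonneg _) hM.le (hθ t hat.le)
        rw [Real.cos_abs] at h4
        rw [abs_signedVersine] at hv
        have h5 : Real.sin (θ t) ^ 2 = (1 - Real.cos (θ t)) * (1 + Real.cos (θ t)) := by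
          rw [Real.sin_sq]; ring
        rw [h5]
        apply mul_le_mul <;> linarith
      have hprod : c * (c * (1 + Real.cos M)) ≤ signedVersine (θ t) * Real.sin (θ t) := by
        have habs : signedVersine (θ t) * Real.sin (θ t)
            = |signedVersine (θ t)| * |Real.sin (θ t)| := by
          rw [← abs_mul, abs_of_nonneg]
          rcases le_total 0 (θ t) with hs | hs
          · exact mul_nonneg (signedVersine_nonneg hs) (Real.sin_nonneg_of_nonneg_of_le_pi hs hπ.2)
          · exact mul_nonneg_of_nonpos_of_nonpos (signedVersine_nonpos hs)
              (Real.sin_nonpos_of_nonpos_of_neg_pi_le hs hπ.1)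
        rw [habs]
        refine mul_le_mul hv.le (hsq.trans ?_) (by positivity) (abs_nonneg _)
        rw [← sq_abs]
        nlinarith [abs_nonneg (Real.sin (θ t)), Real.abs_sin_le_one (θ t)]
      have h6 := mul_le_mul_of_nonneg_right hprod hw
      have h7 : 0 ≤ c * (c * (1 + Real.cos M)) * w t := by positivity
      rw [hl t hat.le]
      nlinarith)
  have h8 := hb b le_rfl
  have h9 := hlarge b hab
  have h10 : l b = 0 := by nlinarith [mul_self_nonneg (l b)]
  have h11 := hl b hab
  have h12 : signedVersine (θ b) = 0 := by linarith
  rw [h12, abs_zero] at h9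
  linarith

theorem exists_within_of_offset_pos (H : SlidingMotion h w l θ) (ha : 0 ≤ a)
    (hM : M < Real.pi) (hθ : ∀ t, a ≤ t → |θ t| ≤ M) (hoff : ∀ t, a ≤ t → 0 < offset l θ t)
    (hc : 0 < c) : ∃ t, 0 ≤ t ∧ Within l θ c t := by
  by_contra! hnot
  obtain ⟨C, hC⟩ := H.exists_forall_abs_position_le
  obtain ⟨a₁, ha₁, hθ₁⟩ := H.eventually_angle_le (M := 0) ha fun t ht hpos =>
    H.heading_lt_of_offset_pos hpos (hoff t ht)
  -- For `θ ≤ 0` and positive offset, `l` dominates both the offset and the versine, so only `l` can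
  -- keep the motion outside `Within l θ c`.
  have hl : ∀ t, a₁ ≤ t → c < l t := by
    intro t ht
    by_contra! hle
    have h1 := hoff t (ha₁.trans ht)
    have h2 := signedVersine_nonpos (hθ₁ t ht)
    refine hnot t (ha.trans (ha₁.trans ht)) ⟨?_, ?_, ?_⟩
    · rw [abs_of_pos h1, offset]; linarith
    · rw [offset] at h1; rw [abs_of_pos (by linarith)]; exact hle
    · rw [offset] at h1; rw [abs_of_nonpos h2]; linarith
  have hcC : c ≤ C := (hl a₁ le_rfl).le.trans
    ((le_abs_self _).trans (hC a₁ (ha.trans ha₁)))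
  obtain ⟨x, hx, hmax⟩ := (isCompact_Icc (a := c) (b := C)).exists_isMaxOn
    ⟨c, le_rfl, hcC⟩ H.continuous_heading.continuousOn
  have hhx : h x < 0 := H.heading_neg x (hc.trans_le hx.1)
  -- Any level in `[h x, 0)` would do: it bounds the target on `[c, C]` and keeps `sin θ` away from
  -- zero.
  obtain ⟨a₂, ha₂, hθ₂⟩ := H.eventually_angle_le (M := h x / 2) (ha.trans ha₁) fun t ht hlt => by
    have : h (l t) ≤ h x := hmax ⟨(hl t ht).le, (le_abs_self _).trans (hC t (ha.trans (ha₁.trans ht)))⟩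
    linarith
  have h02 : 0 ≤ a₂ := ha.trans (ha₁.trans ha₂)
  have hM0 : 0 ≤ M := (abs_nonneg _).trans (hθ a le_rfl)
  have hcosM : 0 < 1 + Real.cos M := by
    have := Real.cos_lt_cos_of_nonneg_of_le_pi hM0 le_rfl hM
    rw [Real.cos_pi] at this
    linarith
  have hcosh : 0 < 1 - Real.cos (-(h x / 2)) := by
    have := Real.cos_lt_cos_of_nonneg_of_le_pi (x := 0) (y := -(h x / 2)) le_rfl
      (by linarith [(abs_lt.1 (H.abs_heading_lt_pi x)).1]) (by linarith)
    rw [Real.cos_zero] at this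
    linarith
  obtain ⟨b, hab, hb⟩ := H.position_ac.eventually_le_of_drift (c := 0)
    (κ := (1 - Real.cos (-(h x / 2))) * (1 + Real.cos M)) h02 (by positivity) H.speed_nonneg
    H.speed_integrable H.tendsto_path_length (by
      filter_upwards [H.ae_hasDerivAt] with t ht hat _
      have h0 := h02.trans_lt hat
      refine ⟨_, ?_, (ht h0).1⟩
      have hneg := hθ₂ t hat.le
      have hsq := sin_sq_lower_bound (θ := θ t) (κ := -(h x / 2)) (by linarith) hM.le
        (by rw [abs_of_nonpos (by linarith)]; linarith) (hθ t (ha₁.trans (ha₂.trans hat.le)))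
      have hs := Real.sin_nonpos_of_nonpos_of_neg_pi_le (hneg.trans (by linarith))
        (abs_le.1 (H.abs_angle_le_pi t h0.le)).1
      have hs' : Real.sin (θ t) ^ 2 ≤ -Real.sin (θ t) := by
        nlinarith [Real.neg_one_le_sin (θ t)]
      have := mul_le_mul_of_nonneg_right (hsq.trans hs') (H.speed_nonneg t h0.le)
      linarith)
  have := hb b le_rfl
  linarith [hl b (ha₂.trans hab)]

theorem exists_within (H : SlidingMotion h w l θ) (hc : 0 < c) : ∃ t, 0 ≤ t ∧ Within l θ c t := by
  obtain ⟨M, hM, a, ha, hθ⟩ := H.exists_eventually_abs_angle_le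
  by_cases hzero : ∃ b, a ≤ b ∧ offset l θ b = 0
  · obtain ⟨b, hab, hb⟩ := hzero
    exact H.exists_within_of_offset_eq_zero (ha.trans hab) hM (fun t ht => hθ t (hab.trans ht)) hb hc
  push Not at hzero
  have hcont : ∀ t, ContinuousOn (offset l θ) (Icc a t) := fun t =>
    H.offset_ac.continuousOn.mono fun s hs => ha.trans hs.1
  rcases (hzero a le_rfl).lt_or_gt with h0 | h0
  · have hneg : ∀ t, a ≤ t → offset l θ t < 0 := by
      intro t ht
      by_contra! hle
      obtain ⟨s, hs, hs'⟩ := intermediate_value_Icc ht (hcont t) ⟨h0.le, hle⟩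
      exact hzero s hs.1 hs'
    obtain ⟨t, ht, h1, h2, h3⟩ := H.neg.exists_within_of_offset_pos ha hM
      (fun t ht => by rw [abs_neg]; exact hθ t ht)
      (fun t ht => by rw [offset_neg]; linarith [hneg t ht]) hc
    rw [offset_neg, abs_neg] at h1
    rw [abs_neg] at h2
    rw [signedVersine_neg, abs_neg] at h3
    exact ⟨t, ht, h1, h2, h3⟩
  · refine H.exists_within_of_offset_pos ha hM hθ (fun t ht => ?_) hc
    by_contra! hle
    obtain ⟨s, hs, hs'⟩ := intermediate_value_Icc' ht (hcont t) ⟨hle, h0.le⟩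
    exact hzero s hs.1 hs'

end SlidingMotion

/-! ### The target heading -/

/-- The heading towards which the hybrid controller steers: `-δ l`, limited by the headings of the
full-rate turns through the origin. -/
noncomputable def targetHeading (δ : ℝ → ℝ) (l : ℝ) : ℝ :=
  max (-Real.arccos (1 - |l|)) (min (Real.arccos (1 - |l|)) (-δ l))

section TargetHeading

variable {δ : ℝ → ℝ}

theorem continuous_targetHeading (hδ : Continuous δ) : Continuous (targetHeading δ) := by
  have h : Continuous fun l : ℝ => Real.arccos (1 - |l|) :=
    Real.continuous_arccos.comp (continuous_const.sub continuous_abs)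
  exact h.neg.max (h.min hδ.neg)

theorem apply_zero_of_mul_pos (hδ : Continuous δ) (hs : ∀ l : ℝ, l ≠ 0 → 0 < l * δ l) :
    δ 0 = 0 := by
  rcases lt_trichotomy (δ 0) 0 with h | h | h
  · have h1 : ∀ᶠ l in 𝓝[>] (0 : ℝ), δ l < 0 :=
      (hδ.continuousAt.eventually_lt continuousAt_const h).filter_mono nhdsWithin_le_nhds
    obtain ⟨l, hl, hl0⟩ := (h1.and self_mem_nhdsWithin).exists
    have hl0 : 0 < l := hl0
    have := hs l hl0.ne'
    nlinarith
  · exact h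
  · have h1 : ∀ᶠ l in 𝓝[<] (0 : ℝ), 0 < δ l :=
      (continuousAt_const.eventually_lt hδ.continuousAt h).filter_mono nhdsWithin_le_nhds
    obtain ⟨l, hl, hl0⟩ := (h1.and self_mem_nhdsWithin).exists
    have hl0 : l < 0 := hl0
    have := hs l hl0.ne
    nlinarith

theorem targetHeading_of_neg (hs : ∀ l : ℝ, l ≠ 0 → 0 < l * δ l) {l : ℝ} (hl : l < 0) :
    targetHeading δ l = min (Real.arccos (1 + l)) (-δ l) := by
  have h1 : δ l < 0 := by have := hs l hl.ne; by_contra! h; nlinarith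
  rw [targetHeading, abs_of_neg hl, sub_neg_eq_add, max_eq_right]
  exact le_min (by linarith [Real.arccos_nonneg (1 + l)])
    (by linarith [Real.arccos_nonneg (1 + l)])

theorem targetHeading_of_pos (hs : ∀ l : ℝ, l ≠ 0 → 0 < l * δ l) {l : ℝ} (hl : 0 < l) :
    targetHeading δ l = -min (Real.arccos (1 - l)) (δ l) := by
  have h1 : 0 < δ l := by have := hs l hl.ne'; by_contra! h; nlinarith
  rw [targetHeading, abs_of_pos hl, min_eq_right (by linarith [Real.arccos_nonneg (1 - l)]),
    max_neg_neg]

theorem abs_targetHeading_le (l : ℝ) : |targetHeading δ l| ≤ Real.arccos (1 - |l|) := by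
  have h := Real.arccos_nonneg (1 - |l|)
  exact abs_le.2 ⟨le_max_left _ _, max_le (by linarith) (min_le_left _ _)⟩

theorem targetHeading_zero (δ : ℝ → ℝ) : targetHeading δ 0 = 0 := by
  have := abs_targetHeading_le (δ := δ) 0
  rw [abs_zero, sub_zero, Real.arccos_one] at this
  exact abs_nonpos_iff.1 this

theorem targetHeading_neg (hs : ∀ l : ℝ, l ≠ 0 → 0 < l * δ l) {l : ℝ} (hl : 0 < l) :
    targetHeading δ l < 0 := by
  have h1 : 0 < δ l := by have := hs l hl.ne'; by_contra! h; nlinarith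
  rw [targetHeading_of_pos hs hl]
  exact neg_lt_zero.2 (lt_min (Real.arccos_pos.2 (by linarith)) h1)

theorem targetHeading_pos (hs : ∀ l : ℝ, l ≠ 0 → 0 < l * δ l) {l : ℝ} (hl : l < 0) :
    0 < targetHeading δ l := by
  have h1 : δ l < 0 := by have := hs l hl.ne; by_contra! h; nlinarith
  rw [targetHeading_of_neg hs hl]
  exact lt_min (Real.arccos_pos.2 (by linarith)) (by linarith)

theorem abs_targetHeading_lt_pi (hs : ∀ l : ℝ, l ≠ 0 → 0 < l * δ l)
    (hb : ∀ l : ℝ, δ l ∈ Ioo (-Real.pi) Real.pi) (l : ℝ) : |targetHeading δ l| < Real.pi := by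
  rcases lt_trichotomy l 0 with hl | rfl | hl
  · rw [abs_of_pos (targetHeading_pos hs hl), targetHeading_of_neg hs hl]
    exact (min_le_right _ _).trans_lt (by linarith [(hb l).1])
  · rw [targetHeading_zero, abs_zero]; exact Real.pi_pos
  · rw [abs_of_neg (targetHeading_neg hs hl), targetHeading_of_pos hs hl, neg_neg]
    exact (min_le_right _ _).trans_lt (hb l).2

end TargetHeading

/-! ### The controller steers towards the target heading -/

/-- The cosine stays at most `cos b` from `|b|` to `2π - |b|` when `|b| ≤ π`. Allowing `|a| > π`
matters because the regularized field at `θ = ±π` sees states on both sides. -/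
theorem abs_lt_abs_of_cos_lt_cos {a b : ℝ} (ha : |a| < 2 * Real.pi - |b|)
    (h : Real.cos b < Real.cos a) : |a| < |b| := by
  by_contra! hle
  rcases le_total |a| Real.pi with hπ | hπ
  · have := Real.cos_le_cos_of_nonneg_of_le_pi (abs_nonneg b) hπ hle
    rw [Real.cos_abs, Real.cos_abs] at this
    linarith
  · have := Real.cos_le_cos_of_nonneg_of_le_pi (x := |b|) (y := 2 * Real.pi - |a|) (abs_nonneg b)
      (by linarith) (by linarith)
    rw [Real.cos_two_pi_sub, Real.cos_abs, Real.cos_abs] at this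
    linarith

theorem lt_cos_of_lt_arccos {x α : ℝ} (h0 : 0 ≤ α) (h : α < Real.arccos x) (hx : x ≤ 1) :
    x < Real.cos α := by
  rcases le_total (-1) x with h1 | h1
  · rw [← Real.cos_arccos h1 hx]
    exact Real.cos_lt_cos_of_nonneg_of_le_pi h0 (Real.arccos_le_pi _) h
  · refine lt_of_le_of_lt h1 ?_
    rw [← Real.cos_pi]
    exact Real.cos_lt_cos_of_nonneg_of_le_pi h0 le_rfl (h.trans_le (Real.arccos_le_pi _))

theorem cos_lt_of_arccos_lt {x α : ℝ} (hπ : α ≤ Real.pi) (h : Real.arccos x < α) (hx : x ≤ 1) :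
    Real.cos α < x := by
  have h1 : -1 ≤ x := (Real.arccos_lt_pi.1 (h.trans_le hπ)).le
  rw [← Real.cos_arccos h1 hx]
  exact Real.cos_lt_cos_of_nonneg_of_le_pi (Real.arccos_nonneg _) hπ h

section Controller

variable {δ : ℝ → ℝ} {p : ℝ × ℝ}

theorem controller_eq_turnRight (hL : ¬(p.2 < 0 ∧ sigmaL p = 0)) (hd : p ∉ darkRegion δ)
    (h : p ∈ lightRegion δ ∨ -δ p.1 < p.2) : (controller δ p).2 = .turnRight := by
  unfold controller
  rw [if_neg hL, if_neg hd]
  rcases h with h | h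
  · rw [if_pos h]; split_ifs <;> rfl
  · rw [if_neg h.not_gt, if_pos h]; split_ifs <;> rfl

theorem controller_eq_turnLeft (hR : ¬(0 < p.2 ∧ sigmaR p = 0)) (hd : p ∉ lightRegion δ)
    (h : p ∈ darkRegion δ ∨ p.2 < -δ p.1) : (controller δ p).2 = .turnLeft := by
  unfold controller
  rw [if_neg hR, if_neg hd]
  rcases h with h | h
  · rw [if_pos h]; split_ifs <;> rfl
  · rw [if_pos h]; split_ifs <;> rfl

theorem controller_of_targetHeading_lt (hδ0 : δ 0 = 0) (hs : ∀ l : ℝ, l ≠ 0 → 0 < l * δ l)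
    (hb : ∀ l : ℝ, δ l ∈ Ioo (-Real.pi) Real.pi) (hp : |p.2| < 2 * Real.pi - |δ p.1|)
    (h : targetHeading δ p.1 < p.2) : (controller δ p).2 = .turnRight := by
  obtain ⟨l, θ⟩ := p
  have hcos := Real.cos_le_one θ
  have hcosδ := Real.cos_le_one (δ l)
  obtain ⟨hb1, hb2⟩ := hb l
  simp only at hp h
  rcases lt_trichotomy l 0 with hl | rfl | hl
  · have hδ : δ l < 0 := by have := hs l hl.ne; by_contra! h; nlinarith
    have hθ : 0 < θ := (targetHeading_pos hs hl).trans h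
    rw [targetHeading_of_neg hs hl, min_lt_iff] at h
    refine controller_eq_turnRight (fun h => absurd h.1 hθ.not_gt) ?_ ?_
    · rintro ⟨hN, ⟨h1, -⟩ | ⟨-, h2⟩⟩
      · exact absurd h1 hθ.not_gt
      · simp only [sigmaN, sigmaR] at hN h2
        -- Adding `sigmaN ≥ 0` and `sigmaR < 0` gives `cos (δ l) < cos θ`: the dark region would
        -- require `θ < -δ l` as well as `θ` below the turn through the origin.
        have h3 := abs_lt_abs_of_cos_lt_cos hp (by linarith)
        rw [abs_of_pos hθ, abs_of_neg hδ] at h3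
        rcases h with h | h
        · have := cos_lt_of_arccos_lt (by linarith) h (by linarith)
          linarith
        · linarith
    -- If `θ ≤ -δ l`, rule 3 does not turn right, but then `θ` lies above the turn through the
    -- origin, and `cos (δ l) ≤ cos θ` places the state in the light region.
    · by_contra! hcon
      obtain ⟨h1, h2⟩ := hcon
      simp only at h2
      have h3 := cos_lt_of_arccos_lt (by linarith) (h.resolve_right (by linarith)) (by linarith)
      have h4 := Real.cos_le_cos_of_nonneg_of_le_pi hθ.le (by linarith) h2
      rw [Real.cos_neg] at h4
      refine h1 ⟨?_, Or.inl ⟨hθ, ?_⟩⟩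
      · simp only [sigmaP]; linarith
      · simp only [sigmaR]; linarith
  · rw [targetHeading_zero] at h
    refine controller_eq_turnRight (fun h' => absurd h'.1 h.not_gt) ?_ (Or.inr ?_)
    · rintro ⟨-, ⟨h1, -⟩ | ⟨-, h2⟩⟩
      · exact absurd h1 h.not_gt
      · simp only [sigmaR] at h2
        linarith
    · simpa [hδ0] using h
  · rw [targetHeading_of_pos hs hl, neg_lt, lt_min_iff] at h
    have h1 : θ < 0 → 1 - l < Real.cos θ := fun hθ => by
      rw [← Real.cos_neg]
      by_contra! hle
      have := Real.arccos_le_arccos hle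
      rw [Real.arccos_cos] at this <;> linarith
    refine controller_eq_turnRight ?_ ?_ (Or.inr ?_)
    · rintro ⟨hθ, h2⟩
      simp only [sigmaL] at h2
      linarith [h1 hθ]
    · rintro ⟨-, ⟨hθ, h2⟩ | ⟨-, h2⟩⟩
      · simp only [sigmaL] at h2
        linarith [h1 hθ]
      · simp only [sigmaR] at h2
        linarith
    · simp only; linarith [h.2]

theorem controller_of_lt_targetHeading (hδ0 : δ 0 = 0) (hs : ∀ l : ℝ, l ≠ 0 → 0 < l * δ l)
    (hb : ∀ l : ℝ, δ l ∈ Ioo (-Real.pi) Real.pi) (hp : |p.2| < 2 * Real.pi - |δ p.1|)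
    (h : p.2 < targetHeading δ p.1) : (controller δ p).2 = .turnLeft := by
  obtain ⟨l, θ⟩ := p
  have hcos := Real.cos_le_one θ
  have hcosδ := Real.cos_le_one (δ l)
  obtain ⟨hb1, hb2⟩ := hb l
  simp only at hp h
  rcases lt_trichotomy l 0 with hl | rfl | hl
  · rw [targetHeading_of_neg hs hl, lt_min_iff] at h
    have h1 : 0 < θ → 1 + l < Real.cos θ := fun hθ =>
      lt_cos_of_lt_arccos hθ.le h.1 (by linarith)
    refine controller_eq_turnLeft ?_ ?_ (Or.inr h.2)
    · rintro ⟨hθ, h2⟩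
      simp only [sigmaR] at h2
      linarith [h1 hθ]
    · rintro ⟨-, ⟨hθ, h2⟩ | ⟨-, h2⟩⟩
      · simp only [sigmaR] at h2
        linarith [h1 hθ]
      · simp only [sigmaL] at h2
        linarith
  · rw [targetHeading_zero] at h
    refine controller_eq_turnLeft (fun h' => absurd h'.1 h.not_gt) ?_ (Or.inr ?_)
    · rintro ⟨-, ⟨h1, -⟩ | ⟨-, h2⟩⟩
      · exact absurd h1 h.not_gt
      · simp only [sigmaL] at h2
        linarith
    · simpa [hδ0] using h
  · have hδ : 0 < δ l := by have := hs l hl.ne'; by_contra! h; nlinarith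
    have hθ : θ < 0 := h.trans (targetHeading_neg hs hl)
    rw [targetHeading_of_pos hs hl, lt_neg, min_lt_iff] at h
    refine controller_eq_turnLeft (fun h => absurd h.1 hθ.not_gt) ?_ ?_
    · rintro ⟨hP, ⟨h1, -⟩ | ⟨-, h2⟩⟩
      · exact absurd h1 hθ.not_gt
      · simp only [sigmaP, sigmaL] at hP h2
        have h3 := abs_lt_abs_of_cos_lt_cos hp (by linarith)
        rw [abs_of_neg hθ, abs_of_pos hδ] at h3
        rcases h with h | h
        · have := cos_lt_of_arccos_lt (by linarith) h (by linarith)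
          rw [Real.cos_neg] at this
          linarith
        · linarith
    · by_contra! hcon
      obtain ⟨h1, h2⟩ := hcon
      simp only at h2
      have h3 := cos_lt_of_arccos_lt (by linarith) (h.resolve_right (by linarith)) (by linarith)
      have h4 := Real.cos_le_cos_of_nonneg_of_le_pi (x := -θ) (y := δ l) (by linarith)
        (by linarith) (by linarith)
      rw [Real.cos_neg] at h3 h4
      refine h1 ⟨?_, Or.inl ⟨hθ, ?_⟩⟩
      · simp only [sigmaN]; linarith
      · simp only [sigmaL]; linarith

end Controller

/-! ### Trajectories of the closed loop are sliding motions -/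

theorem krasovskii_subset {f : ℝ × ℝ → ℝ × ℝ} {p : ℝ × ℝ} {C : Set (ℝ × ℝ)} (hC : IsClosed C)
    (hconv : Convex ℝ C) (h : ∀ᶠ q in 𝓝 p, f q ∈ C) : krasovskii f p ⊆ C := by
  obtain ⟨ε, hε, hball⟩ := Metric.eventually_nhds_iff_ball.1 h
  refine (iInter₂_subset ε hε).trans (closure_minimal (convexHull_min ?_ hconv) hC)
  rintro _ ⟨q, hq, rfl⟩
  exact hball q hq

section Krasovskii

variable {δ : ℝ → ℝ} {R v : ℝ} {p y : ℝ × ℝ}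

/-- This component is continuous and independent of the manoeuvre, so regularization leaves it
single-valued. -/
theorem fst_eq_of_mem_krasovskii (hy : y ∈ krasovskii (closedLoopField δ R v) p) :
    y.1 = v / R * Real.sin p.2 := by
  have hcont : Continuous fun q : ℝ × ℝ => v * Real.sin q.2 / R := by fun_prop
  have hle : ∀ ε > 0, dist y.1 (v * Real.sin p.2 / R) ≤ ε := by
    intro ε hε
    have hsub := krasovskii_subset (f := closedLoopField δ R v) (p := p)
      (C := Prod.fst ⁻¹' Metric.closedBall (v * Real.sin p.2 / R) ε)
      (Metric.isClosed_closedBall.preimage continuous_fst)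
      ((convex_closedBall _ _).linear_preimage (LinearMap.fst ℝ ℝ ℝ))
      (hcont.continuousAt.eventually (Metric.closedBall_mem_nhds _ hε))
    exact hsub hy
  have := dist_le_zero.1 (le_of_forall_pos_le_add fun ε hε => by simpa using hle ε hε)
  rw [this]; ring

theorem snd_eq_of_mem_krasovskii {u : ℝ} (hy : y ∈ krasovskii (closedLoopField δ R v) p)
    (h : ∀ᶠ q in 𝓝 p, (controller δ q).2.angularVelocity v R = u) : y.2 = u :=
  krasovskii_subset (C := Prod.snd ⁻¹' {u}) (isClosed_singleton.preimage continuous_snd)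
    ((convex_singleton u).linear_preimage (LinearMap.snd ℝ ℝ ℝ)) h hy

theorem abs_snd_le_of_mem_krasovskii (hv : 0 ≤ v / R)
    (hy : y ∈ krasovskii (closedLoopField δ R v) p) : |y.2| ≤ v / R := by
  have hsub := krasovskii_subset (f := closedLoopField δ R v) (p := p)
    (C := Prod.snd ⁻¹' Icc (-(v / R)) (v / R))
    (isClosed_Icc.preimage continuous_snd)
    ((convex_Icc _ _).linear_preimage (LinearMap.snd ℝ ℝ ℝ))
    (Eventually.of_forall fun q => by
      simp only [mem_preimage, mem_Icc, closedLoopField, vehicleField]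
      cases (controller δ q).2 <;> simp only [Manoeuvre.angularVelocity] <;>
        constructor <;> linarith)
  exact abs_le.2 (hsub hy)

theorem isOpen_abs_snd_lt (hδ : Continuous δ) :
    IsOpen {q : ℝ × ℝ | |q.2| < 2 * Real.pi - |δ q.1|} :=
  isOpen_lt (by fun_prop) (by fun_prop)

theorem isOpen_targetHeading_lt (hδ : Continuous δ) :
    IsOpen {q : ℝ × ℝ | targetHeading δ q.1 < q.2} :=
  isOpen_lt ((continuous_targetHeading hδ).comp continuous_fst) continuous_snd

theorem isOpen_lt_targetHeading (hδ : Continuous δ) :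
    IsOpen {q : ℝ × ℝ | q.2 < targetHeading δ q.1} :=
  isOpen_lt continuous_snd ((continuous_targetHeading hδ).comp continuous_fst)

end Krasovskii

section Trajectory

variable {R : ℝ} {v δ : ℝ → ℝ} {x : ℝ → ℝ × ℝ}

theorem locallyAC_fst (hx : x ∈ closedLoopTrajectories δ R v) : LocallyAC fun t => (x t).1 :=
  fun T hT => LipschitzWith.prod_fst.comp_absolutelyContinuousOnInterval (hx.1 T hT)

theorem locallyAC_snd (hx : x ∈ closedLoopTrajectories δ R v) : LocallyAC fun t => (x t).2 :=
  fun T hT => LipschitzWith.prod_snd.comp_absolutelyContinuousOnInterval (hx.1 T hT)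

theorem ae_hasDerivAt_of_mem_closedLoopTrajectories (hR : 0 < R)
    (hv_pos : ∀ t : ℝ, 0 ≤ t → 0 < v t) (hδ : Continuous δ)
    (hb : ∀ l : ℝ, δ l ∈ Ioo (-Real.pi) Real.pi) (hs : ∀ l : ℝ, l ≠ 0 → 0 < l * δ l)
    (hx : x ∈ closedLoopTrajectories δ R v) :
    ∀ᵐ t : ℝ, 0 < t → HasDerivAt (fun t => (x t).1) (v t / R * Real.sin (x t).2) t ∧
      ∃ u, HasDerivAt (fun t => (x t).2) u t ∧ |u| ≤ v t / R ∧
        (|(x t).2| < 2 * Real.pi - |δ (x t).1| →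
          (targetHeading δ (x t).1 < (x t).2 → u = -(v t / R)) ∧
          ((x t).2 < targetHeading δ (x t).1 → u = v t / R)) := by
  have hδ0 := apply_zero_of_mul_pos hδ hs
  filter_upwards [hx.2] with t ht h0
  obtain ⟨y, hy, hd⟩ := ht h0
  have h1 : HasDerivAt (fun t => (x t).1) y.1 t :=
    (ContinuousLinearMap.fst ℝ ℝ ℝ).hasFDerivAt.comp_hasDerivAt t hd
  have h2 : HasDerivAt (fun t => (x t).2) y.2 t :=
    (ContinuousLinearMap.snd ℝ ℝ ℝ).hasFDerivAt.comp_hasDerivAt t hd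
  refine ⟨by rwa [fst_eq_of_mem_krasovskii hy] at h1, y.2, h2,
    abs_snd_le_of_mem_krasovskii (div_pos (hv_pos t h0.le) hR).le hy, fun hW => ⟨fun h => ?_,
    fun h => ?_⟩⟩
  · refine snd_eq_of_mem_krasovskii hy ?_
    filter_upwards [(isOpen_abs_snd_lt hδ).mem_nhds hW, (isOpen_targetHeading_lt hδ).mem_nhds h]
      with q hq1 hq2
    rw [controller_of_targetHeading_lt hδ0 hs hb hq1 hq2, Manoeuvre.angularVelocity]
  · refine snd_eq_of_mem_krasovskii hy ?_
    filter_upwards [(isOpen_abs_snd_lt hδ).mem_nhds hW, (isOpen_lt_targetHeading hδ).mem_nhds h]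
      with q hq1 hq2
    rw [controller_of_lt_targetHeading hδ0 hs hb hq1 hq2, Manoeuvre.angularVelocity]

theorem exists_forall_mem_of_isOpen (hx : x ∈ closedLoopTrajectories δ R v) {s : ℝ} (hs : 0 ≤ s)
    {U : Set (ℝ × ℝ)} (hU : IsOpen U) (hxs : x s ∈ U) : ∃ r > s, ∀ t, s < t → t < r → x t ∈ U := by
  have hcont : ContinuousWithinAt x (Ici 0) s :=
    ((locallyAC_fst hx).continuousOn s hs).prodMk ((locallyAC_snd hx).continuousOn s hs)
  have h1 : ∀ᶠ t in 𝓝[>] s, x t ∈ U :=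
    (hcont.mono fun t (ht : s < t) => hs.trans ht.le).eventually (hU.mem_nhds hxs)
  obtain ⟨r, hr, hr'⟩ := mem_nhdsGT_iff_exists_Ioo_subset.1 h1
  exact ⟨r, hr, fun t h1 h2 => hr' ⟨h1, h2⟩⟩

/-- At `θ = ±π` the state lies in the open set `|θ| < 2π - |δ l|`, where the steering law holds, and
the target is strictly inside `(-π, π)`. The vehicle therefore turns inwards for some time
afterwards, which is all a local barrier needs. -/
theorem abs_snd_le_pi_of_mem_closedLoopTrajectories (hR : 0 < R)
    (hv_pos : ∀ t : ℝ, 0 ≤ t → 0 < v t) (hδ : Continuous δ)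
    (hb : ∀ l : ℝ, δ l ∈ Ioo (-Real.pi) Real.pi) (hs : ∀ l : ℝ, l ≠ 0 → 0 < l * δ l)
    (hx : x ∈ closedLoopTrajectories δ R v) (h0 : |(x 0).2| ≤ Real.pi) :
    ∀ t, 0 ≤ t → |(x t).2| ≤ Real.pi := by
  have hder := ae_hasDerivAt_of_mem_closedLoopTrajectories hR hv_pos hδ hb hs hx
  have hW : ∀ t, |(x t).2| = Real.pi → |(x t).2| < 2 * Real.pi - |δ (x t).1| := fun t ht => by
    rw [ht]
    linarith [abs_lt.2 (hb (x t).1)]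
  have hh : ∀ t, |targetHeading δ (x t).1| < Real.pi := fun t => abs_targetHeading_lt_pi hs hb _
  intro t ht
  refine abs_le.2 ⟨?_, ?_⟩
  · have := (locallyAC_snd hx).neg.le_of_local_barrier le_rfl
      (by linarith [(abs_le.1 h0).1] : -(x 0).2 ≤ Real.pi) (fun s hs0 hsπ => ?_) t ht
    · linarith
    · obtain ⟨r, hr, hr'⟩ := exists_forall_mem_of_isOpen hx hs0
        ((isOpen_abs_snd_lt hδ).inter (isOpen_lt_targetHeading hδ))
        ⟨hW s (by rw [← abs_neg, hsπ, abs_of_pos Real.pi_pos]), by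
          simp only [mem_ofPred_eq]; linarith [(abs_lt.1 (hh s)).1]⟩
      refine ⟨r, hr, ?_⟩
      filter_upwards [hder] with t ht hst htr _
      obtain ⟨-, u, hu, -, hu'⟩ := ht (hs0.trans_lt hst)
      refine ⟨-u, ?_, hu.fun_neg⟩
      rw [(hu' (hr' t hst htr).1).2 (hr' t hst htr).2]
      linarith [div_pos (hv_pos t (hs0.trans hst.le)) hR]
  · refine (locallyAC_snd hx).le_of_local_barrier le_rfl (abs_le.1 h0).2 (fun s hs0 hsπ => ?_) t ht
    obtain ⟨r, hr, hr'⟩ := exists_forall_mem_of_isOpen hx hs0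
      ((isOpen_abs_snd_lt hδ).inter (isOpen_targetHeading_lt hδ))
      ⟨hW s (by rw [hsπ, abs_of_pos Real.pi_pos]), by
        simp only [mem_ofPred_eq]; linarith [(abs_lt.1 (hh s)).2]⟩
    refine ⟨r, hr, ?_⟩
    filter_upwards [hder] with t ht hst htr _
    obtain ⟨-, u, hu, -, hu'⟩ := ht (hs0.trans_lt hst)
    refine ⟨u, ?_, hu⟩
    rw [(hu' (hr' t hst htr).1).1 (hr' t hst htr).2]
    linarith [div_pos (hv_pos t (hs0.trans hst.le)) hR]

theorem slidingMotion_of_mem_closedLoopTrajectories (hR : 0 < R)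
    (hv_cont : ContinuousOn v (Ici 0)) (hv_pos : ∀ t : ℝ, 0 ≤ t → 0 < v t)
    (hv_dist : Tendsto (fun t : ℝ => ∫ s in (0 : ℝ)..t, v s) atTop atTop) (hδ : Continuous δ)
    (hb : ∀ l : ℝ, δ l ∈ Ioo (-Real.pi) Real.pi) (hs : ∀ l : ℝ, l ≠ 0 → 0 < l * δ l)
    (hx : x ∈ closedLoopTrajectories δ R v) (h0 : |(x 0).2| ≤ Real.pi) :
    SlidingMotion (targetHeading δ) (fun t => v t / R) (fun t => (x t).1) fun t => (x t).2 where
  continuous_heading := continuous_targetHeading hδ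
  heading_neg _ := targetHeading_neg hs
  heading_pos _ := targetHeading_pos hs
  abs_heading_lt_pi := abs_targetHeading_lt_pi hs hb
  abs_heading_le := abs_targetHeading_le
  speed_nonneg t ht := (div_pos (hv_pos t ht) hR).le
  speed_integrable t ht := by
    refine ContinuousOn.intervalIntegrable ((hv_cont.mono ?_).div_const R)
    rw [uIcc_of_le ht]
    exact Icc_subset_Ici_self
  tendsto_path_length := by
    simp only [intervalIntegral.integral_div]
    exact hv_dist.atTop_div_const hR
  position_ac := locallyAC_fst hx
  heading_ac := locallyAC_snd hx
  abs_angle_le_pi := abs_snd_le_pi_of_mem_closedLoopTrajectories hR hv_pos hδ hb hs hx h0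
  ae_hasDerivAt := by
    filter_upwards [ae_hasDerivAt_of_mem_closedLoopTrajectories hR hv_pos hδ hb hs hx]
      with t ht ht0
    obtain ⟨h1, u, h2, h3, h4⟩ := ht ht0
    have hπ := abs_snd_le_pi_of_mem_closedLoopTrajectories hR hv_pos hδ hb hs hx h0 t ht0.le
    have h5 := h4 (by linarith [abs_lt.2 (hb (x t).1)])
    exact ⟨h1, u, h2, h3, h5.1, h5.2⟩

end Trajectory

/-! ### Neighbourhoods of the origin and the conclusion -/

namespace SlidingMotion

theorem exists_within_imp_abs_lt {ε : ℝ} (hε : 0 < ε) :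
    ∃ c > 0, ∀ (l θ : ℝ → ℝ) (t : ℝ), |θ t| ≤ Real.pi → Within l θ c t → |l t| < ε ∧ |θ t| < ε := by
  have hπ := Real.pi_pos
  -- The second entry comes from `1 - cos θ ≥ (2 / π²) θ²` on `[-π, π]`, which gives `2 θ² ≤ ε²`.
  refine ⟨min (ε / 2) (1 / Real.pi ^ 2 * ε ^ 2), by positivity, fun l θ t hθ hw => ?_⟩
  obtain ⟨-, h2, h3⟩ := hw
  refine ⟨by linarith [h2.trans (min_le_left _ _)], ?_⟩
  rw [abs_signedVersine] at h3
  have h4 := Real.cos_le_one_sub_mul_cos_sq hθ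
  have h5 : 2 / Real.pi ^ 2 * θ t ^ 2 ≤ 1 / Real.pi ^ 2 * ε ^ 2 := by
    linarith [h3.trans (min_le_right _ _)]
  have h6 : 2 * θ t ^ 2 ≤ ε ^ 2 := by
    have : 0 < 1 / Real.pi ^ 2 := by positivity
    refine le_of_mul_le_mul_left ?_ this
    calc _ = 2 / Real.pi ^ 2 * θ t ^ 2 := by ring
      _ ≤ _ := h5
  exact abs_lt_of_sq_lt_sq (by nlinarith [sq_nonneg (θ t), pow_pos hε 2]) hε.le

theorem within_of_abs_le {l θ : ℝ → ℝ} {c t : ℝ} (hl : |l t| ≤ c / 2) (hθ : |θ t| ≤ c / 2) :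
    Within l θ c t := by
  have h1 : |signedVersine (θ t)| ≤ |θ t| := by
    have := lipschitzWith_signedVersine.dist_le_mul (θ t) 0
    simpa [signedVersine_zero, Real.dist_eq] using this
  have h2 := abs_nonneg (l t)
  refine ⟨(abs_add_le _ _).trans (by linarith), by linarith, by linarith⟩

end SlidingMotion

theorem theorem1 (R : ℝ) (hR : 0 < R)
    (v : ℝ → ℝ) (hv_cont : ContinuousOn v (Ici 0)) (hv_pos : ∀ t : ℝ, 0 ≤ t → 0 < v t)
    (hv_dist : Tendsto (fun t : ℝ => ∫ s in (0 : ℝ)..t, v s) atTop atTop)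
    (δ : ℝ → ℝ) (hδ_cont : Continuous δ) (hδ_bdd : ∀ l : ℝ, δ l ∈ Ioo (-Real.pi) Real.pi)
    (hδ_sign : ∀ l : ℝ, l ≠ 0 → 0 < l * δ l) :
    AsymptoticallyStableOn (closedLoopTrajectories δ R v)
      {p : ℝ × ℝ | p.2 ∈ Ico (-Real.pi) Real.pi} (0, 0) := by
  have hmotion : ∀ x ∈ closedLoopTrajectories δ R v, (x 0).2 ∈ Ico (-Real.pi) Real.pi →
      SlidingMotion (targetHeading δ) (fun t => v t / R) (fun t => (x t).1) fun t => (x t).2 :=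
    fun x hx h0 => slidingMotion_of_mem_closedLoopTrajectories hR hv_cont hv_pos hv_dist hδ_cont
      hδ_bdd hδ_sign hx (abs_le.2 ⟨h0.1, h0.2.le⟩)
  have hdist : ∀ p : ℝ × ℝ, dist p (0, 0) = max |p.1| |p.2| := fun p => by
    simp [Prod.dist_eq]
  refine ⟨fun ε hε => ?_, fun x hx h0 => ?_⟩
  · obtain ⟨c, hc, hc'⟩ := SlidingMotion.exists_within_imp_abs_lt hε
    refine ⟨c / 2, by positivity, fun x hx h0 hη t ht => ?_⟩
    have H := hmotion x hx h0
    rw [hdist, max_lt_iff] at hη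
    rw [hdist, max_lt_iff]
    exact hc' _ _ t (H.abs_angle_le_pi t ht)
      (H.within_of_within le_rfl (SlidingMotion.within_of_abs_le hη.1.le hη.2.le) t ht)
  · rw [Metric.tendsto_atTop]
    intro ε hε
    obtain ⟨c, hc, hc'⟩ := SlidingMotion.exists_within_imp_abs_lt hε
    have H := hmotion x hx h0
    obtain ⟨T, hT, hw⟩ := H.exists_within hc
    refine ⟨T, fun t ht => ?_⟩
    rw [hdist, max_lt_iff]
    exact hc' _ _ t (H.abs_angle_le_pi t (hT.trans ht)) (H.within_of_within hT hw t ht)
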